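/- Let $h \geq 2$ be an integer. For a set $A$ of integers and $n\in\mathbf Z$, let $r_{A,h}(n) \in \mathbf N_0\cup\{\infty\}$ be the number of ways to write $n = a_1+a_2+\cdots+a_h$ with $a_1,\ldots,a_h\in A$ and $a_1\leq a_2\leq\cdots\leq a_h$, and let $\hat r_{A,h}(n)\in \mathbf N_0\cup\{\infty\}$ be the number of ways to write $n$ as a sum of $h$ pairwise distinct elements of $A$, the order of the summands being disregarded. For real $x$, let $A(-x,x)$ be the number of $a\in A$ with $-x\leq a\leq x$. Write $A(-x,x)\gg x^{1/(2h-1)}$ if there are real numbers $c_0>0$ and $x_0$ (which may depend on $A$) such that $|A(-x,x)|\geq c_0\,|x^{1/(2h-1)}|$ for all real $x\geq x_0$. Let $f:\mathbf Z\to\mathbf N_0\cup\{\infty\}$ be any function such that $f^{-1}(0)$ is finite. Then there exist uncountably many sets $A$ of integers such that $$r_{A,h}(n)=f(n)\quad\text{for all } n\in\mathbf Z \qquad\text{and}\qquad A(-x,x)\gg x^{1/(2h-1)},$$ and there exist uncountably many sets $A$ of integers such that $$\hat r_{A,h}(n)=f(n)\quad\text{for all } n\in\mathbf Z \qquad\text{and}\qquad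 A(-x,x)\gg x^{1/(2h-1)}.$$ -/

import Mathlib

noncomputable section

/-- The representation function `r_{A,h}`: the number (possibly infinite) of ways to write `n` as
`a₁ + ⋯ + a_h` with `a₁, …, a_h ∈ A` and `a₁ ≤ ⋯ ≤ a_h`. -/
def repFun (A : Set ℤ) (h : ℕ) (n : ℤ) : ℕ∞ :=
  {a : Fin h → ℤ | Monotone a ∧ (∀ i, a i ∈ A) ∧ ∑ i, a i = n}.encard

/-- The restricted representation function: the number (possibly infinite) of ways to write `n`
as a sum of `h` pairwise distinct elements of `A`, the order of the summands being irrelevant. -/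
def restrictedRepFun (A : Set ℤ) (h : ℕ) (n : ℤ) : ℕ∞ :=
  {s : Finset ℤ | s.card = h ∧ (∀ a ∈ s, a ∈ A) ∧ ∑ a ∈ s, a = n}.encard

/-- The counting function `A(y, x)`: the number of `a ∈ A` with `y ≤ a ≤ x`
(always a finite number). -/
def countFun (A : Set ℤ) (y x : ℝ) : ℕ :=
  {a : ℤ | a ∈ A ∧ y ≤ (a : ℝ) ∧ (a : ℝ) ≤ x}.ncard

/-- `f ≫ g` for functions of a real variable: there are `c₀ > 0` and `x₀` such that
`|f x| ≥ c₀ |g x|` for all `x ≥ x₀`. -/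
def MuchGreater (f g : ℝ → ℝ) : Prop :=
  ∃ c₀ : ℝ, 0 < c₀ ∧ ∃ x₀ : ℝ, ∀ x : ℝ, x₀ ≤ x → c₀ * |g x| ≤ |f x|

end

/-!
The set `A` is the union of an increasing sequence of finite sets built greedily. Both claims are
treated at once: for any property `P` of multisets that holds for all multisets without repetition,
`reps P h A n` is the set of representations of `n` by `h`-element multisets from `A` with `P`.

One step adjoins to a finite set `A` the `h` elements `l i * c`, one of them shifted by `u`
(`newElt`), where the integers `l i` have sum `0`. Their sum is a new representation of `u`, and `u`
is chosen with fewer than `f u` representations so far. The `l i` are powers of a large base,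
completed by minus their sum; hence (`exists_balanced_coeffs`) two combinations of the `l i` of
weight at most `h` agree only if they are equal, or one is empty and the other uses each `l i` once.
An accidental equality between two different sums therefore determines `c`, up to boundedly many
choices, from an `h`-fold and an `(h - 1)`-fold sum of elements of `A`: at most `2 h - 1` elements
of `A` are involved, because if neither side used a new element there would be nothing to avoid. So
some `c` of size `O(|A| ^ (2 h - 1))` is generic (`exists_isGeneric`), whatever the size of `u`. For
such `c`, all other new sums are distinct from each other and from all old sums and avoid the finite
set `f ⁻¹' {0}`, so they are represented once, which `f` permits (`reps_extend_self`,
`reps_extend_of_ne`). This needs that sums of fewer than `h` elements of `A` are all distinct, a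
property which the same argument preserves (`smallSumsInjective_extend`).

Running through a list in which each integer occurs infinitely often brings the number of
representations of every `n` up to `f n`. The `k`-th step adjoins an element of size
`O(k ^ (2 h - 1))`, which gives the growth. For uncountability, each step also forbids forever an
element of the `k`-th set `B k` of a given sequence, if `B k` has an element outside the current
stage; thus the result differs from every `B k` (`exists_set_reps_eq`).
-/

/-! ### Balanced coefficients and generic multipliers -/

/-- Uniqueness of base `b` expansions with signed digits, for the expansion of `0`. -/
theorem eq_zero_of_sum_mul_pow_eq_zero {b : ℤ} :
    ∀ (g : ℕ) (x : Fin g → ℤ), (∀ i, |x i| < b) → ∑ i, x i * b ^ (i : ℕ) = 0 → ∀ i, x i = 0 := by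
  intro g
  induction g with
  | zero => intro x _ _ i; exact i.elim0
  | succ g ih =>
    intro x hx hs
    have hb : 0 < b := (abs_nonneg _).trans_lt (hx 0)
    rw [Fin.sum_univ_succ] at hs
    have h1 : ∑ i : Fin g, x i.succ * b ^ ((i.succ : Fin (g + 1)) : ℕ)
        = b * ∑ i : Fin g, x i.succ * b ^ (i : ℕ) := by
      rw [Finset.mul_sum]
      refine Finset.sum_congr rfl fun i _ => ?_
      rw [Fin.val_succ, pow_succ]; ring
    rw [h1] at hs
    simp only [Fin.val_zero, pow_zero, mul_one] at hs
    have h0 : x 0 = 0 := by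
      refine Int.eq_zero_of_abs_lt_dvd (m := b) ?_ (hx 0)
      exact ⟨-∑ i : Fin g, x i.succ * b ^ (i : ℕ), by linarith⟩
    rw [h0, zero_add] at hs
    have h2 := (mul_eq_zero.mp hs).resolve_left hb.ne'
    have h3 := ih (fun i => x i.succ) (fun i => hx _) h2
    intro i
    refine Fin.cases h0 h3 i

theorem eq_one_and_eq_zero_of_forall_lt {h : ℕ} {m m' : Fin h → ℕ} (hm : ∑ i, m i ≤ h)
    (hlt : ∀ i, m' i < m i) : m = 1 ∧ m' = 0 := by
  have h1 : ∑ i, (m' i + 1) ≤ ∑ i, m i := Finset.sum_le_sum fun i _ => hlt i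
  rw [Finset.sum_add_distrib] at h1
  simp only [Finset.sum_const, Finset.card_univ, Fintype.card_fin, smul_eq_mul, mul_one] at h1
  have h2 : ∑ i, m' i = 0 := by omega
  have h3 : ∀ i, m' i = 0 := by simpa [Finset.sum_eq_zero_iff] using h2
  have h4 : ∑ i : Fin h, 1 = ∑ i, m i := by
    simp only [Finset.sum_const, Finset.card_univ, Fintype.card_fin, smul_eq_mul, mul_one]
    omega
  have h5 := (Finset.sum_eq_sum_iff_of_le (s := Finset.univ) (f := fun _ : Fin h => 1) (g := m)
    fun i _ => (Nat.zero_le _).trans_lt (hlt i)).mp h4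
  exact ⟨funext fun i => (h5 i (Finset.mem_univ i)).symm, funext h3⟩

theorem exists_balanced_coeffs (h : ℕ) (hh : 2 ≤ h) :
    ∃ l : Fin h → ℤ, ∑ i, l i = 0 ∧ ∀ m m' : Fin h → ℕ, ∑ i, m i ≤ h → ∑ i, m' i ≤ h →
      ∑ i, (m i : ℤ) * l i = ∑ i, (m' i : ℤ) * l i →
      m = m' ∨ (m = 1 ∧ m' = 0) ∨ (m = 0 ∧ m' = 1) := by
  obtain ⟨g, rfl⟩ : ∃ g, h = g + 1 := ⟨h - 1, by omega⟩
  -- differences of two multiplicity vectors, shifted by one of their entries, lie in `[-2h, 2h]`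
  -- so they are admissible digits in base `2h + 1`
  set b : ℤ := 2 * ((g + 1 : ℕ) : ℤ) + 1 with hb
  refine ⟨Fin.cons (-∑ i : Fin g, b ^ (i : ℕ)) fun i => b ^ (i : ℕ),
    by simp [Fin.sum_univ_succ], ?_⟩
  intro m m' hm hm' heq
  have hle : ∀ i, m i ≤ g + 1 := fun i =>
    (Finset.single_le_sum (fun _ _ => Nat.zero_le _) (Finset.mem_univ i)).trans hm
  have hle' : ∀ i, m' i ≤ g + 1 := fun i =>
    (Finset.single_le_sum (fun _ _ => Nat.zero_le _) (Finset.mem_univ i)).trans hm'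
  have key : ∀ i : Fin g, ((m i.succ : ℤ) - m' i.succ) - (m 0 - m' 0) = 0 := by
    refine eq_zero_of_sum_mul_pow_eq_zero (b := b) g
      (fun i : Fin g => ((m i.succ : ℤ) - m' i.succ) - (m 0 - m' 0)) ?_ ?_
    · intro i
      have := hle 0; have := hle' 0; have := hle i.succ; have := hle' i.succ
      rw [abs_lt]; constructor <;> push_cast [hb] <;> omega
    · simp only [Fin.sum_univ_succ, Fin.cons_zero, Fin.cons_succ] at heq
      simp only [sub_mul, Finset.sum_sub_distrib, ← Finset.mul_sum]
      linarith
  have key' : ∀ i, (m i : ℤ) - m' i = m 0 - m' 0 := by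
    intro i
    refine Fin.cases rfl (fun i => ?_) i
    linarith [key i]
  rcases lt_trichotomy (m 0) (m' 0) with h0 | h0 | h0
  · right; right
    have := eq_one_and_eq_zero_of_forall_lt hm' (m' := m) fun i => by have := key' i; omega
    exact ⟨this.2, this.1⟩
  · left
    funext i
    have := key' i; omega
  · right; left
    exact eq_one_and_eq_zero_of_forall_lt hm fun i => by have := key' i; omega

/-- Each pair of `t` and an element of `D` excludes at most one `c`. -/
theorem exists_mul_notMem (D : Finset ℤ) (T : ℕ) :
    ∃ c : ℤ, 1 ≤ c ∧ c ≤ (2 * T + 1) * D.card + 1 ∧ ∀ t : ℤ, t ≠ 0 → |t| ≤ T → t * c ∉ D := by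
  classical
  set bad : Finset ℤ := (Finset.Icc (-(T : ℤ)) T ×ˢ D).image fun p => p.2 / p.1
  have hbad : bad.card ≤ (2 * T + 1) * D.card := by
    refine Finset.card_image_le.trans ?_
    rw [Finset.card_product, Int.card_Icc]
    refine Nat.mul_le_mul_right _ ?_
    omega
  have hcard : bad.card < (Finset.Icc (1 : ℤ) ((2 * T + 1) * D.card + 1)).card := by
    rw [Int.card_Icc]
    have : (((2 * T + 1) * D.card : ℕ) : ℤ) = (2 * T + 1) * D.card := by push_cast; ring
    omega
  obtain ⟨c, hc, hcb⟩ := Finset.exists_mem_notMem_of_card_lt_card hcard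
  rw [Finset.mem_Icc] at hc
  refine ⟨c, hc.1, hc.2, fun t ht htT hD => hcb ?_⟩
  refine Finset.mem_image.mpr ⟨(t, t * c), ?_, Int.mul_ediv_cancel_left c ht⟩
  exact Finset.mem_product.mpr ⟨Finset.mem_Icc.mpr (abs_le.mp htT), hD⟩

open scoped Pointwise in
theorem multiset_sum_mem_nsmul {A : Finset ℤ} (n : ℕ) (S : Multiset ℤ) (hS : ∀ a ∈ S, a ∈ A)
    (hn : S.card ≤ n) : S.sum ∈ n • insert 0 A := by
  classical
  induction S using Multiset.induction generalizing n with
  | empty =>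
    have := Finset.nsmul_mem_nsmul (n := n) (Finset.mem_insert_self 0 A)
    simpa using this
  | cons a S ih =>
    obtain ⟨n, rfl⟩ : ∃ k, n = k + 1 := ⟨n - 1, by rw [Multiset.card_cons] at hn; omega⟩
    rw [Multiset.sum_cons, add_comm a, succ_nsmul]
    refine Finset.add_mem_add (ih n (fun x hx => hS x (Multiset.mem_cons_of_mem hx)) ?_) ?_
    · rw [Multiset.card_cons] at hn; omega
    · exact Finset.mem_insert_of_mem (hS a (Multiset.mem_cons_self a S))

/-- The multiples `t * c` with `0 < |t| ≤ T` avoid every value forced by a coincidence: a sum of at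
most `h` elements of `A`, or an element of `Z`, minus a sum of fewer than `h` elements of `A`, up to
a multiple `v * u` with `|v| ≤ h`. -/
def IsGeneric (h T : ℕ) (A Z : Finset ℤ) (u c : ℤ) : Prop :=
  ∀ t v : ℤ, ∀ x : ℤ, ∀ S : Multiset ℤ, t ≠ 0 → |t| ≤ T → |v| ≤ h → (∀ a ∈ S, a ∈ A) →
    S.card < h → (x ∈ Z ∨ ∃ S' : Multiset ℤ, (∀ a ∈ S', a ∈ A) ∧ S'.card ≤ h ∧ x = S'.sum) →
    t * c ≠ x - S.sum + v * u

open scoped Pointwise in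
theorem exists_isGeneric (h T : ℕ) (hh : 2 ≤ h) (A Z : Finset ℤ) (u : ℤ) :
    ∃ c : ℤ, 1 ≤ c ∧
      c ≤ (2 * T + 1) * (((A.card + 1) ^ h + Z.card) * (A.card + 1) ^ (h - 1) * (2 * h + 1)) + 1 ∧
      IsGeneric h T A Z u c := by
  classical
  set A₀ := insert 0 A
  set V : Finset ℤ := (Finset.Icc (-(h : ℤ)) h).image (· * u)
  set D : Finset ℤ := (h • A₀ ∪ Z) - (h - 1) • A₀ + V
  have hA₀ : A₀.card ≤ A.card + 1 := Finset.card_insert_le _ _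
  have hpow : ∀ n : ℕ, (n • A₀).card ≤ (A.card + 1) ^ n := fun n =>
    (Finset.card_nsmul_le).trans (Nat.pow_le_pow_left hA₀ n)
  have hV : V.card ≤ 2 * h + 1 := by
    refine Finset.card_image_le.trans ?_
    rw [Int.card_Icc]; omega
  have hD : D.card ≤ ((A.card + 1) ^ h + Z.card) * (A.card + 1) ^ (h - 1) * (2 * h + 1) := by
    refine (Finset.card_add_le).trans (Nat.mul_le_mul ((Finset.card_sub_le).trans
      (Nat.mul_le_mul ((Finset.card_union_le _ _).trans ?_) (hpow _))) hV)
    exact Nat.add_le_add_right (hpow _) _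
  obtain ⟨c, hc1, hc2, hc⟩ := exists_mul_notMem D T
  refine ⟨c, hc1, hc2.trans ?_, ?_⟩
  · gcongr
    exact_mod_cast hD
  · intro t v x S ht htT hv hS hSc hx heq
    refine hc t ht htT ?_
    rw [heq]
    refine Finset.add_mem_add (Finset.sub_mem_sub ?_ (multiset_sum_mem_nsmul _ S hS (by omega)))
      (Finset.mem_image_of_mem _ (Finset.mem_Icc.mpr (abs_le.mp hv)))
    rcases hx with hx | ⟨S', hS', hSc', rfl⟩
    · exact Finset.mem_union_right _ hx
    · exact Finset.mem_union_left _ (multiset_sum_mem_nsmul _ S' hS' hSc')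

/-! ### Adjoining a representation of `u` -/

/-- The representations of `n` as the sum of an `h`-element multiset of elements of `A` that
satisfies `P`. With `P` always true these are counted by `repFun`, with `P = Multiset.Nodup` by
`restrictedRepFun`. -/
def reps (P : Multiset ℤ → Prop) (h : ℕ) (A : Set ℤ) (n : ℤ) : Set (Multiset ℤ) :=
  {M | M.card = h ∧ P M ∧ (∀ a ∈ M, a ∈ A) ∧ M.sum = n}

/-- Sums of fewer than `h` elements of `A`, repetitions allowed, determine their summands. -/
def SmallSumsInjective (h : ℕ) (A : Set ℤ) : Prop :=
  ∀ S S' : Multiset ℤ, (∀ a ∈ S, a ∈ A) → (∀ a ∈ S', a ∈ A) → S.card < h → S'.card < h →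
    S.sum = S'.sum → S = S'

/-- The coefficients `l` sum to `0`, and, up to exchanging the two sides, this is the only
coincidence between nonnegative integer combinations of total weight at most `h`. -/
def IsBalanced {h : ℕ} (l : Fin h → ℤ) : Prop :=
  ∑ i, l i = 0 ∧ ∀ m m' : Fin h → ℕ, ∑ i, m i ≤ h → ∑ i, m' i ≤ h →
    ∑ i, (m i : ℤ) * l i = ∑ i, (m' i : ℤ) * l i → m = m' ∨ (m = 1 ∧ m' = 0) ∨ (m = 0 ∧ m' = 1)

/-- The elements adjoined to a set in order to represent `u`: multiples of `c` by balanced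
coefficients, one of them shifted by `u`, so that their sum is `u`. -/
def newElt {h : ℕ} (l : Fin h → ℤ) (i₀ : Fin h) (u c : ℤ) (i : Fin h) : ℤ :=
  l i * c + if i = i₀ then u else 0

/-- The multiset consisting of `S` and of `m i` copies of each `a i`. -/
def adjoin {h : ℕ} (a : Fin h → ℤ) (S : Multiset ℤ) (m : Fin h → ℕ) : Multiset ℤ :=
  S + ∑ i, m i • ({a i} : Multiset ℤ)

theorem exists_eq_adjoin {h : ℕ} (A : Set ℤ) (a : Fin h → ℤ) (M : Multiset ℤ)
    (hM : ∀ x ∈ M, x ∈ A ∨ ∃ i, a i = x) :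
    ∃ S m, (∀ x ∈ S, x ∈ A) ∧ M = adjoin a S m := by
  induction M using Multiset.induction with
  | empty => exact ⟨0, 0, by simp, by simp [adjoin]⟩
  | cons x M ih =>
    obtain ⟨S, m, hS, rfl⟩ := ih fun y hy => hM y (Multiset.mem_cons_of_mem hy)
    rcases hM x (Multiset.mem_cons_self _ _) with hx | ⟨i, rfl⟩
    · refine ⟨x ::ₘ S, m, ?_, by simp [adjoin]⟩
      intro y hy
      rcases Multiset.mem_cons.mp hy with rfl | hy
      exacts [hx, hS y hy]
    · refine ⟨S, m + Pi.single i 1, hS, ?_⟩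
      have h1 : ∑ j, (Pi.single i 1 : Fin h → ℕ) j • ({a j} : Multiset ℤ) = {a i} := by
        rw [Finset.sum_eq_single i]
        · simp
        · intro j _ hj; simp [hj]
        · simp
      simp only [adjoin, Pi.add_apply, add_smul, Finset.sum_add_distrib, h1]
      rw [← Multiset.singleton_add]
      abel

theorem card_adjoin {h : ℕ} (a : Fin h → ℤ) (S : Multiset ℤ) (m : Fin h → ℕ) :
    (adjoin a S m).card = S.card + ∑ i, m i := by
  simp [adjoin]

theorem sum_adjoin_newElt {h : ℕ} (l : Fin h → ℤ) (i₀ : Fin h) (u c : ℤ) (S : Multiset ℤ)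
    (m : Fin h → ℕ) : (adjoin (newElt l i₀ u c) S m).sum
      = S.sum + (∑ i, (m i : ℤ) * l i) * c + m i₀ * u := by
  simp only [adjoin, newElt, Multiset.sum_add, Multiset.sum_sum, Multiset.sum_nsmul,
    Multiset.sum_singleton, nsmul_eq_mul, mul_add, Finset.sum_add_distrib, mul_ite, mul_zero,
    Finset.sum_ite_eq', Finset.mem_univ, if_true, Finset.sum_mul, mul_assoc, add_assoc]

theorem abs_sum_sub_le {h : ℕ} (l : Fin h → ℤ) {m m' : Fin h → ℕ} (hm : ∑ i, m i ≤ h)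
    (hm' : ∑ i, m' i ≤ h) :
    |∑ i, (m i : ℤ) * l i - ∑ i, (m' i : ℤ) * l i| ≤ ((h * ∑ i, (l i).natAbs : ℕ) : ℤ) := by
  rw [← Finset.sum_sub_distrib, Nat.cast_mul, Nat.cast_sum, Finset.mul_sum]
  refine (Finset.abs_sum_le_sum_abs _ _).trans (Finset.sum_le_sum fun i _ => ?_)
  have h1 : m i ≤ h :=
    (Finset.single_le_sum (fun _ _ => Nat.zero_le _) (Finset.mem_univ i)).trans hm
  have h2 : m' i ≤ h :=
    (Finset.single_le_sum (fun _ _ => Nat.zero_le _) (Finset.mem_univ i)).trans hm'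
  rw [← sub_mul, abs_mul, Int.natCast_natAbs]
  refine mul_le_mul_of_nonneg_right ?_ (abs_nonneg _)
  rw [abs_le]; constructor <;> omega

section Extension

variable {h T : ℕ} {l : Fin h → ℤ} {i₀ : Fin h} {A Z : Finset ℤ} {u c : ℤ}

/-- For generic `c`, equal sums have equal coefficients of `c`, provided one of them uses fewer than
`h` old elements. -/
theorem coeff_eq_of_sum_eq (hT : h * ∑ i, (l i).natAbs ≤ T) (hg : IsGeneric h T A Z u c)
    {S : Multiset ℤ} {m : Fin h → ℕ} (hS : ∀ a ∈ S, a ∈ A) (hSc : S.card < h)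
    (hm : ∑ i, m i ≤ h) {S' : Multiset ℤ} {m' : Fin h → ℕ} (hS' : ∀ a ∈ S', a ∈ A)
    (hSc' : S'.card ≤ h) (hm' : ∑ i, m' i ≤ h)
    (heq : (adjoin (newElt l i₀ u c) S m).sum = (adjoin (newElt l i₀ u c) S' m').sum) :
    ∑ i, (m i : ℤ) * l i = ∑ i, (m' i : ℤ) * l i := by
  by_contra hne
  rw [sum_adjoin_newElt, sum_adjoin_newElt] at heq
  have h1 : m i₀ ≤ h :=
    (Finset.single_le_sum (fun _ _ => Nat.zero_le _) (Finset.mem_univ i₀)).trans hm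
  have h2 : m' i₀ ≤ h :=
    (Finset.single_le_sum (fun _ _ => Nat.zero_le _) (Finset.mem_univ i₀)).trans hm'
  refine hg _ ((m' i₀ : ℤ) - m i₀) S'.sum S (sub_ne_zero.mpr hne)
    ((abs_sum_sub_le l hm hm').trans (by exact_mod_cast hT)) ?_ hS hSc
    (Or.inr ⟨S', hS', hSc', rfl⟩) ?_
  · rw [abs_le]; constructor <;> omega
  · linarith

theorem coeff_eq_zero_of_sum_mem (hT : h * ∑ i, (l i).natAbs ≤ T) (hg : IsGeneric h T A Z u c)
    {S : Multiset ℤ} {m : Fin h → ℕ} (hS : ∀ a ∈ S, a ∈ A) (hSc : S.card < h)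
    (hm : ∑ i, m i ≤ h) (hz : (adjoin (newElt l i₀ u c) S m).sum ∈ Z) :
    ∑ i, (m i : ℤ) * l i = 0 := by
  by_contra hne
  have h1 : m i₀ ≤ h :=
    (Finset.single_le_sum (fun _ _ => Nat.zero_le _) (Finset.mem_univ i₀)).trans hm
  have hb := abs_sum_sub_le l hm (m' := 0) (by simp)
  simp only [Pi.zero_apply, Nat.cast_zero, zero_mul, Finset.sum_const_zero, sub_zero] at hb
  refine hg _ (-(m i₀ : ℤ)) _ S hne (hb.trans (by exact_mod_cast hT)) ?_ hS hSc (Or.inl hz) ?_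
  · rw [abs_neg, Nat.abs_cast]; exact_mod_cast h1
  · rw [sum_adjoin_newElt]; ring

theorem adjoin_zero_single (a : Fin h → ℤ) (i : Fin h) : adjoin a 0 (Pi.single i 1) = {a i} := by
  rw [adjoin, zero_add, Finset.sum_eq_single i]
  · simp
  · intro j _ hj; simp [hj]
  · simp

theorem sum_single_one (i : Fin h) : ∑ j, (Pi.single i 1 : Fin h → ℕ) j = 1 := by simp

theorem sum_newElt_adjoin_single (i : Fin h) :
    (adjoin (newElt l i₀ u c) 0 (Pi.single i 1)).sum = newElt l i₀ u c i := by
  rw [adjoin_zero_single, Multiset.sum_singleton]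

theorem single_ne_one (hh : 2 ≤ h) (i : Fin h) : (Pi.single i 1 : Fin h → ℕ) ≠ 1 := by
  intro heq
  have := sum_single_one i
  rw [heq] at this
  simp at this
  omega

theorem single_ne_zero (i : Fin h) : (Pi.single i 1 : Fin h → ℕ) ≠ 0 := by
  intro heq
  have := congrFun heq i
  simp at this

theorem IsBalanced.eq_or {m m' : Fin h → ℕ} (hl : IsBalanced l) (hm : ∑ i, m i ≤ h)
    (hm' : ∑ i, m' i ≤ h) (h0 : m ≠ 0) (h1 : m ≠ 1)
    (heq : ∑ i, (m i : ℤ) * l i = ∑ i, (m' i : ℤ) * l i) : m = m' := by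
  rcases hl.2 m m' hm hm' heq with h2 | ⟨h2, -⟩ | ⟨h2, -⟩
  exacts [h2, absurd h2 h1, absurd h2 h0]

theorem IsBalanced.sum_ne_zero {m : Fin h → ℕ} (hl : IsBalanced l) (hm : ∑ i, m i ≤ h)
    (h0 : m ≠ 0) (h1 : m ≠ 1) : ∑ i, (m i : ℤ) * l i ≠ 0 := fun heq =>
  h0 (hl.eq_or (m' := 0) hm (by simp) h0 h1 (by simpa using heq))

theorem newElt_notMem_avoided (hh : 2 ≤ h) (hl : IsBalanced l)
    (hT : h * ∑ i, (l i).natAbs ≤ T) (hg : IsGeneric h T A Z u c) (i : Fin h) :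
    newElt l i₀ u c i ∉ Z := by
  intro hz
  rw [← sum_newElt_adjoin_single] at hz
  have hs : ∑ j, (Pi.single i 1 : Fin h → ℕ) j ≤ h := by rw [sum_single_one]; omega
  exact hl.sum_ne_zero hs (single_ne_zero i) (single_ne_one hh i)
    (coeff_eq_zero_of_sum_mem hT hg (by simp) (by simp; omega) hs hz)

theorem newElt_notMem (hh : 2 ≤ h) (hl : IsBalanced l)
    (hT : h * ∑ i, (l i).natAbs ≤ T) (hg : IsGeneric h T A Z u c) (i : Fin h) :
    newElt l i₀ u c i ∉ A := by
  intro hA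
  have hs : ∑ j, (Pi.single i 1 : Fin h → ℕ) j ≤ h := by rw [sum_single_one]; omega
  have h1 := coeff_eq_of_sum_eq (i₀ := i₀) hT hg (S := 0) (by simp) (by simp; omega) hs
    (S' := {newElt l i₀ u c i}) (m' := 0) (by simpa using hA) (by simp; omega) (by simp)
    (by rw [sum_newElt_adjoin_single]; simp [adjoin])
  exact hl.sum_ne_zero hs (single_ne_zero i) (single_ne_one hh i) (by simpa using h1)

theorem newElt_injective (hh : 2 ≤ h) (hl : IsBalanced l)
    (hT : h * ∑ i, (l i).natAbs ≤ T) (hg : IsGeneric h T A Z u c) :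
    Function.Injective (newElt l i₀ u c) := by
  intro i j hij
  have hs : ∀ i, ∑ j, (Pi.single i 1 : Fin h → ℕ) j ≤ h := fun i => by
    rw [sum_single_one]; omega
  have h1 := coeff_eq_of_sum_eq (i₀ := i₀) hT hg (S := 0) (by simp) (by simp; omega) (hs i)
    (S' := 0) (by simp) (by simp) (hs j)
    (by rw [sum_newElt_adjoin_single, sum_newElt_adjoin_single, hij])
  have h2 := hl.eq_or (hs i) (hs j) (single_ne_zero i) (single_ne_one hh i) h1
  by_contra hne
  have := congrFun h2 i
  simp [hne] at this

/-- With fewer than `h` summands the exceptional coincidence of balanced coefficients cannot occur,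
since it uses all `h` new elements. -/
theorem smallSumsInjective_extend (hl : IsBalanced l)
    (hT : h * ∑ i, (l i).natAbs ≤ T) (hg : IsGeneric h T A Z u c)
    (hA : SmallSumsInjective h A) :
    SmallSumsInjective h (A ∪ Set.range (newElt l i₀ u c)) := by
  intro M M' hM hM' hMc hMc' heq
  obtain ⟨S, m, hS, rfl⟩ := exists_eq_adjoin A (newElt l i₀ u c) M hM
  obtain ⟨S', m', hS', rfl⟩ := exists_eq_adjoin A (newElt l i₀ u c) M' hM'
  rw [card_adjoin] at hMc hMc'
  have h1 := coeff_eq_of_sum_eq hT hg hS (by omega) (by omega) hS' (by omega) (by omega) heq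
  have hmm : m = m' := by
    rcases hl.2 m m' (by omega) (by omega) h1 with h2 | ⟨h2, -⟩ | ⟨-, h2⟩
    · exact h2
    · subst h2; simp at hMc
    · subst h2; simp at hMc'
  subst hmm
  rw [sum_adjoin_newElt, sum_adjoin_newElt] at heq
  rw [hA S S' hS hS' (by omega) (by omega) (by linarith)]

/-- An `h`-fold sum that uses a new element, other than the sum of all the new elements, is not in
`Z` and determines its summands. -/
theorem eq_of_sum_eq_of_new (hl : IsBalanced l)
    (hT : h * ∑ i, (l i).natAbs ≤ T) (hg : IsGeneric h T A Z u c)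
    (hA : SmallSumsInjective h A) {S : Multiset ℤ} {m : Fin h → ℕ} (hS : ∀ a ∈ S, a ∈ A)
    (hc : S.card + ∑ i, m i = h) (h0 : m ≠ 0) (h1 : m ≠ 1) :
    (adjoin (newElt l i₀ u c) S m).sum ∉ Z ∧
    ∀ M : Multiset ℤ, M.card = h → (∀ a ∈ M, a ∈ (A ∪ Set.range (newElt l i₀ u c) : Set ℤ)) →
      (adjoin (newElt l i₀ u c) S m).sum = M.sum → adjoin (newElt l i₀ u c) S m = M := by
  have hpos : 0 < ∑ i, m i := by
    refine Nat.pos_of_ne_zero fun hz => h0 (funext fun i => ?_)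
    exact (Finset.sum_eq_zero_iff.mp hz) i (Finset.mem_univ i)
  refine ⟨fun hz => hl.sum_ne_zero (by omega) h0 h1
    (coeff_eq_zero_of_sum_mem hT hg hS (by omega) (by omega) hz), ?_⟩
  intro M hMc hM heq
  obtain ⟨S', m', hS', rfl⟩ := exists_eq_adjoin A (newElt l i₀ u c) M hM
  rw [card_adjoin] at hMc
  have hmm := hl.eq_or (by omega) (by omega) h0 h1
    (coeff_eq_of_sum_eq hT hg hS (by omega) (by omega) hS' (by omega) (by omega) heq)
  subst hmm
  rw [sum_adjoin_newElt, sum_adjoin_newElt] at heq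
  rw [hA S S' hS hS' (by omega) (by omega) (by linarith)]

theorem mem_adjoin {a : Fin h → ℤ} {S : Multiset ℤ} {m : Fin h → ℕ} {x : ℤ} :
    x ∈ adjoin a S m ↔ x ∈ S ∨ ∃ i, m i ≠ 0 ∧ x = a i := by
  simp [adjoin, Multiset.mem_sum, Multiset.mem_nsmul]

theorem sum_all_newElt (hl : IsBalanced l) : (adjoin (newElt l i₀ u c) 0 1).sum = u := by
  rw [sum_adjoin_newElt]
  simp [hl.1]

/-- The target `u` gains exactly one representation, by the sum of all the new elements. -/
theorem reps_extend_self {P : Multiset ℤ → Prop} (hP : ∀ M, M.Nodup → P M) (hh : 2 ≤ h)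
    (hl : IsBalanced l) (hT : h * ∑ i, (l i).natAbs ≤ T) (hg : IsGeneric h T A Z u c)
    (hA : SmallSumsInjective h A) :
    (reps P h (A ∪ Set.range (newElt l i₀ u c)) u).encard = (reps P h A u).encard + 1 := by
  have hnotin : adjoin (newElt l i₀ u c) 0 1 ∉ reps P h A u := fun hmem =>
    newElt_notMem hh hl hT hg i₀ (hmem.2.2.1 _ (mem_adjoin.mpr (Or.inr ⟨i₀, by simp, rfl⟩)))
  rw [← Set.encard_insert_of_notMem hnotin]
  congr 1
  ext M
  constructor
  · rintro ⟨hMc, hPM, hM, hMs⟩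
    obtain ⟨S, m, hS, rfl⟩ := exists_eq_adjoin A (newElt l i₀ u c) M hM
    rw [card_adjoin] at hMc
    by_cases h0 : m = 0
    · subst h0
      right
      have h2 : adjoin (newElt l i₀ u c) S 0 = S := by simp [adjoin]
      rw [h2] at hPM hMs ⊢
      exact ⟨by simpa using hMc, hPM, hS, hMs⟩
    · by_cases h1 : m = 1
      · subst h1
        left
        have : S = 0 := by
          rw [← Multiset.card_eq_zero]
          simpa using hMc
        rw [this]
      · left
        refine (eq_of_sum_eq_of_new hl hT hg hA hS hMc h0 h1).2 _ ?_ ?_ ?_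
        · rw [card_adjoin]; simp
        · intro x hx
          rcases mem_adjoin.mp hx with hx | ⟨i, -, rfl⟩
          · simp at hx
          · exact Or.inr ⟨i, rfl⟩
        · rw [hMs, sum_all_newElt hl]
  · rintro (rfl | ⟨hMc, hPM, hM, hMs⟩)
    · refine ⟨by rw [card_adjoin]; simp, hP _ ?_, ?_, sum_all_newElt hl⟩
      · have : adjoin (newElt l i₀ u c) 0 1
            = Multiset.map (newElt l i₀ u c) Finset.univ.val := by
          simp only [adjoin, zero_add, Pi.one_apply, one_smul]
          rw [← Multiset.sum_map_singleton (Multiset.map _ _), Multiset.map_map]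
          rfl
        rw [this]
        exact Finset.univ.nodup.map (newElt_injective hh hl hT hg)
      · intro x hx
        rcases mem_adjoin.mp hx with hx | ⟨i, -, rfl⟩
        · simp at hx
        · exact Or.inr ⟨i, rfl⟩
    · exact ⟨hMc, hPM, fun a ha => Or.inl (hM a ha), hMs⟩

/-- An integer other than `u` keeps its representations, or else it is outside `Z` and its only
representation is a new one. -/
theorem reps_extend_of_ne {P : Multiset ℤ → Prop}
    (hl : IsBalanced l) (hT : h * ∑ i, (l i).natAbs ≤ T) (hg : IsGeneric h T A Z u c)
    (hA : SmallSumsInjective h A) {n : ℤ} (hn : n ≠ u) :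
    reps P h (A ∪ Set.range (newElt l i₀ u c)) n = reps P h A n ∨
      (n ∉ Z ∧ (reps P h (A ∪ Set.range (newElt l i₀ u c)) n).encard ≤ 1) := by
  by_cases hnew : reps P h (A ∪ Set.range (newElt l i₀ u c)) n ⊆ reps P h A n
  · left
    refine hnew.antisymm ?_
    rintro M ⟨hMc, hPM, hM, hMs⟩
    exact ⟨hMc, hPM, fun a ha => Or.inl (hM a ha), hMs⟩
  · right
    obtain ⟨M, ⟨hMc, hPM, hM, hMs⟩, hMn⟩ := Set.not_subset.mp hnew
    obtain ⟨S, m, hS, rfl⟩ := exists_eq_adjoin A (newElt l i₀ u c) M hM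
    rw [card_adjoin] at hMc
    have h0 : m ≠ 0 := by
      rintro rfl
      refine hMn ⟨by rw [card_adjoin]; exact hMc, hPM, ?_, hMs⟩
      simpa [adjoin] using hS
    have h1 : m ≠ 1 := by
      rintro rfl
      have : S = 0 := by
        rw [← Multiset.card_eq_zero]
        simpa using hMc
      subst this
      exact hn (hMs.symm.trans (sum_all_newElt hl))
    obtain ⟨hz, huniq⟩ := eq_of_sum_eq_of_new (i₀ := i₀) hl hT hg hA hS hMc h0 h1
    refine ⟨hMs ▸ hz, Set.encard_le_one_iff.mpr ?_⟩
    rintro M₁ M₂ ⟨hc₁, -, hm₁, hs₁⟩ ⟨hc₂, -, hm₂, hs₂⟩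
    rw [← huniq M₁ hc₁ hm₁ (hMs.trans hs₁.symm), huniq M₂ hc₂ hm₂ (hMs.trans hs₂.symm)]

end Extension

/-! ### The greedy construction -/

theorem reps_mono (P : Multiset ℤ → Prop) (h : ℕ) {A A' : Set ℤ} (hA : A ⊆ A') (n : ℤ) :
    reps P h A n ⊆ reps P h A' n := fun _ ⟨hc, hp, hm, hs⟩ =>
  ⟨hc, hp, fun a ha => hA (hm a ha), hs⟩

/-- A finite stage `A` of the construction after `k` steps, together with a finite set `E` of
integers that are never to be adjoined. -/
structure IsStage (P : Multiset ℤ → Prop) (h : ℕ) (f : ℤ → ℕ∞) (k : ℕ) (A E : Finset ℤ) :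
    Prop where
  disjoint : ∀ a ∈ A, a ∉ E
  card_le : A.card ≤ h * k
  card_avoided_le : E.card ≤ k
  injective : SmallSumsInjective h A
  reps_le : ∀ n, (reps P h A n).encard ≤ f n

/-- The bound of `exists_isGeneric` grows like `k ^ (2 * h - 1)` along the stages; `z` stands for
the number of zeros of `f`. -/
theorem bound_le (h T k a e z : ℕ) (hh : 2 ≤ h) (ha : a ≤ h * k) (he : e ≤ z + (k + 1)) :
    (2 * T + 1) * (((a + 1) ^ h + e) * (a + 1) ^ (h - 1) * (2 * h + 1)) + 1
      ≤ ((2 * T + 1) * (z + 2) * (2 * h + 1) * h ^ (2 * h - 1) + 1) * (k + 1) ^ (2 * h - 1) := by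
  have h1 : a + 1 ≤ h * (k + 1) := by rw [mul_add]; omega
  have h2 : k + 1 ≤ (h * (k + 1)) ^ h :=
    (Nat.le_mul_of_pos_left _ (by omega)).trans (Nat.le_self_pow (by omega) _)
  have h3 : e ≤ (z + 1) * (h * (k + 1)) ^ h := by
    have : z * 1 ≤ z * (h * (k + 1)) ^ h := Nat.mul_le_mul_left _ (by omega)
    rw [add_mul, one_mul]; omega
  have h4 : (a + 1) ^ h + e ≤ (z + 2) * (h * (k + 1)) ^ h := by
    have := Nat.pow_le_pow_left h1 h
    linarith
  have h5 : (h * (k + 1)) ^ h * (h * (k + 1)) ^ (h - 1)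
      = h ^ (2 * h - 1) * (k + 1) ^ (2 * h - 1) := by
    rw [← pow_add, ← mul_pow]; congr 1; omega
  have h6 : 1 ≤ (k + 1) ^ (2 * h - 1) := Nat.one_le_pow _ _ (by omega)
  calc _ ≤ (2 * T + 1) * (((z + 2) * (h * (k + 1)) ^ h) * (h * (k + 1)) ^ (h - 1) * (2 * h + 1))
        + (k + 1) ^ (2 * h - 1) := by gcongr
    _ = (2 * T + 1) * (z + 2) * (2 * h + 1) * ((h * (k + 1)) ^ h * (h * (k + 1)) ^ (h - 1))
        + (k + 1) ^ (2 * h - 1) := by ring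
    _ = _ := by rw [h5]; ring

open scoped Pointwise in
/-- An integer that still lacks representations exists at each stage, because a finite set
represents only finitely many integers; `v` is taken if it qualifies. -/
theorem exists_target (P : Multiset ℤ → Prop) (h : ℕ) (f : ℤ → ℕ∞) (Z : Finset ℤ)
    (hZ : ∀ n, f n = 0 → n ∈ Z) (A : Finset ℤ) (v : ℤ) :
    ∃ u, (reps P h A u).encard < f u ∧ ((reps P h A v).encard < f v → u = v) := by
  by_cases hv : (reps P h A v).encard < f v
  · exact ⟨v, hv, fun _ => rfl⟩
  · obtain ⟨u, hu⟩ := Infinite.exists_notMem_finset (h • insert 0 A ∪ Z)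
    rw [Finset.mem_union, not_or] at hu
    refine ⟨u, ?_, fun hv' => absurd hv' hv⟩
    have : reps P h A u = ∅ := by
      rw [Set.eq_empty_iff_forall_notMem]
      rintro M ⟨hMc, -, hM, rfl⟩
      exact hu.1 (multiset_sum_mem_nsmul h M hM hMc.le)
    rw [this, Set.encard_empty]
    exact pos_iff_ne_zero.mpr fun h0 => hu.2 (hZ u h0)

/-- One step, with target `v` and with `B` the set from which the result is to differ. -/
theorem IsStage.exists_next {P : Multiset ℤ → Prop} (hP : ∀ M, M.Nodup → P M) {h : ℕ} (hh : 2 ≤ h)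
    {f : ℤ → ℕ∞} (hf : (f ⁻¹' {0}).Finite) :
    ∃ C : ℕ, ∀ k A E, IsStage P h f k A E → ∀ (v : ℤ) (B : Set ℤ), ∃ A' E',
      IsStage P h f (k + 1) A' E' ∧ A ⊆ A' ∧ E ⊆ E' ∧
      ((reps P h A v).encard < f v → (reps P h A v).encard + 1 ≤ (reps P h A' v).encard) ∧
      (∃ a ∈ A', a ∉ A ∧ |a| ≤ C * (k + 1) ^ (2 * h - 1)) ∧
      (B ⊆ A ∨ ∃ e ∈ E', e ∈ B) := by
  classical
  obtain ⟨l, hl⟩ := exists_balanced_coeffs h hh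
  change IsBalanced l at hl
  set T := h * ∑ i, (l i).natAbs with hT
  set Z := hf.toFinset with hZdef
  have hZ : ∀ n, f n = 0 → n ∈ Z := fun n hn => by simpa [hZdef] using hn
  set i₀ : Fin h := ⟨0, by omega⟩
  set i₁ : Fin h := ⟨1, by omega⟩
  have hi : i₁ ≠ i₀ := by simp [i₁, i₀]
  refine ⟨(l i₁).natAbs * ((2 * T + 1) * (Z.card + 2) * (2 * h + 1) * h ^ (2 * h - 1) + 1), ?_⟩
  intro k A E hst v B
  obtain ⟨E', hEE', hE'c, hAE', hB⟩ : ∃ E' : Finset ℤ, E ⊆ E' ∧ E'.card ≤ k + 1 ∧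
      (∀ a ∈ A, a ∉ E') ∧ (B ⊆ A ∨ ∃ e ∈ E', e ∈ B) := by
    by_cases hB : B ⊆ A
    · exact ⟨E, subset_rfl, hst.card_avoided_le.trans (by omega), hst.disjoint, Or.inl hB⟩
    · obtain ⟨e, heB, heA⟩ := Set.not_subset.mp hB
      refine ⟨insert e E, Finset.subset_insert _ _, (Finset.card_insert_le _ _).trans
        (Nat.succ_le_succ hst.card_avoided_le), ?_, Or.inr ⟨e, Finset.mem_insert_self _ _, heB⟩⟩
      intro a ha hae
      rcases Finset.mem_insert.mp hae with rfl | hae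
      exacts [heA ha, hst.disjoint a ha hae]
  obtain ⟨u, hu, huv⟩ := exists_target P h f Z hZ A v
  obtain ⟨c, hc1, hc, hg⟩ := exists_isGeneric h T hh A (Z ∪ E') u
  set a := newElt l i₀ u c
  have hcoe : ((A ∪ Finset.univ.image a : Finset ℤ) : Set ℤ) = (A : Set ℤ) ∪ Set.range a := by simp
  have hself := reps_extend_self (i₀ := i₀) hP hh hl hT.ge hg hst.injective
  refine ⟨A ∪ Finset.univ.image a, E', ⟨?_, ?_, hE'c, ?_, ?_⟩, Finset.subset_union_left, hEE',
    ?_, ⟨a i₁, ?_, newElt_notMem hh hl hT.ge hg i₁, ?_⟩, hB⟩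
  · intro x hx
    rcases Finset.mem_union.mp hx with hx | hx
    · exact hAE' x hx
    · obtain ⟨i, -, rfl⟩ := Finset.mem_image.mp hx
      exact fun hE => newElt_notMem_avoided hh hl hT.ge hg i (Finset.mem_union_right _ hE)
  · refine (Finset.card_union_le _ _).trans ?_
    have := Finset.card_image_le (s := Finset.univ) (f := a)
    rw [Finset.card_univ, Fintype.card_fin] at this
    have := hst.card_le
    rw [mul_add]; omega
  · rw [hcoe]
    exact smallSumsInjective_extend hl hT.ge hg hst.injective
  · intro n
    rw [hcoe]
    by_cases hn : n = u
    · subst hn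
      rw [hself]
      exact Order.add_one_le_of_lt hu
    · rcases reps_extend_of_ne (P := P) (i₀ := i₀) hl hT.ge hg hst.injective hn with h1 | ⟨h1, h2⟩
      · rw [h1]; exact hst.reps_le n
      · refine h2.trans (Order.one_le_iff_pos.mpr (pos_iff_ne_zero.mpr fun h0 => h1 ?_))
        exact Finset.mem_union_left _ (hZ n h0)
  · intro hv
    rw [hcoe, ← huv hv]
    exact hself.ge
  · exact Finset.mem_union_right _ (Finset.mem_image_of_mem _ (Finset.mem_univ _))
  · have h1 : a i₁ = l i₁ * c := by simp [a, newElt, hi]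
    have h2 : c ≤ (((2 * T + 1) * (Z.card + 2) * (2 * h + 1) * h ^ (2 * h - 1) + 1)
        * (k + 1) ^ (2 * h - 1) : ℕ) := by
      refine hc.trans ?_
      have he : (Z ∪ E').card ≤ Z.card + (k + 1) :=
        (Finset.card_union_le _ _).trans (Nat.add_le_add_left hE'c _)
      exact_mod_cast bound_le h T k A.card _ Z.card hh hst.card_le he
    rw [h1, abs_mul, abs_of_pos (show 0 < c by omega), ← Int.natCast_natAbs (l i₁)]
    refine (mul_le_mul_of_nonneg_left h2 (by positivity)).trans_eq ?_
    push_cast; ring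

theorem reps_iUnion {P : Multiset ℤ → Prop} {h : ℕ} {A : ℕ → Finset ℤ} (hA : Monotone A) (n : ℤ) :
    reps P h (⋃ k, (A k : Set ℤ)) n = ⋃ k, reps P h (A k) n := by
  refine Set.Subset.antisymm ?_
    (Set.iUnion_subset fun k => reps_mono P h (Set.subset_iUnion (fun k => (A k : Set ℤ)) k) n)
  rintro M ⟨hMc, hPM, hM, hMs⟩
  have hAc : Monotone fun k => (A k : Set ℤ) := fun i j hij => Finset.coe_subset.mpr (hA hij)
  obtain ⟨k, hk⟩ := hAc.directed_le.exists_mem_subset_of_finset_subset_biUnion (s := M.toFinset)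
    fun a ha => hM a (by simpa using ha)
  exact Set.mem_iUnion.mpr ⟨k, hMc, hPM, fun a ha => hk (by simpa using ha), hMs⟩

theorem encard_iUnion_le {α : Type*} {s : ℕ → Set α} (hs : Monotone s) {c : ℕ∞}
    (hc : ∀ k, (s k).encard ≤ c) : (⋃ k, s k).encard ≤ c := by
  refine ENat.forall_natCast_le_iff_le.mp fun j hj => ?_
  obtain ⟨t, ht, htj⟩ := Set.exists_subset_encard_eq hj
  have hfin : t.Finite := Set.finite_of_encard_eq_coe htj
  obtain ⟨k, hk⟩ := hs.directed_le.exists_mem_subset_of_finset_subset_biUnion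
    (s := hfin.toFinset) (by simpa using ht)
  rw [Set.Finite.coe_toFinset] at hk
  exact htj ▸ (Set.encard_le_encard hk).trans (hc k)

/-- The greedy construction. The elements `α k` witness the growth of `A`, and `B` lists sets from
which `A` is to differ. -/
theorem exists_set_reps_eq {P : Multiset ℤ → Prop} (hP : ∀ M, M.Nodup → P M) {h : ℕ} (hh : 2 ≤ h)
    {f : ℤ → ℕ∞} (hf : (f ⁻¹' {0}).Finite) (B : ℕ → Set ℤ) :
    ∃ A : Set ℤ, (∀ n, (reps P h A n).encard = f n) ∧ (∀ k, A ≠ B k) ∧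
      ∃ (C : ℕ) (α : ℕ → ℤ), α.Injective ∧
        ∀ k, α k ∈ A ∧ |α k| ≤ C * ((k : ℤ) + 1) ^ (2 * h - 1) := by
  obtain ⟨C, hC⟩ := IsStage.exists_next hP hh hf
  -- a list of the integers in which each one occurs infinitely often
  obtain ⟨v, hv⟩ : ∃ v : ℕ → ℤ, ∀ n K, ∃ k, K ≤ k ∧ v k = n :=
    ⟨fun k => Denumerable.ofNat ℤ k.unpair.1, fun n K =>
      ⟨Nat.pair (Encodable.encode n) K, Nat.right_le_pair _ _, by
        simp only [Nat.unpair_pair]; exact Denumerable.ofNat_encode n⟩⟩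
  have h0 : IsStage P h f 0 ∅ ∅ := by
    refine ⟨by simp, by simp, by simp, ?_, fun n => ?_⟩
    · intro S S' hS hS' _ _ _
      rw [Multiset.eq_zero_of_forall_notMem (s := S) fun a ha => by simpa using hS a ha,
        Multiset.eq_zero_of_forall_notMem (s := S') fun a ha => by simpa using hS' a ha]
    · have : reps P h ((∅ : Finset ℤ) : Set ℤ) n = ∅ := by
        rw [Set.eq_empty_iff_forall_notMem]
        rintro M ⟨hMc, -, hM, -⟩
        rw [Multiset.eq_zero_of_forall_notMem (s := M) fun a ha => by simpa using hM a ha] at hMc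
        simp at hMc
        omega
      rw [this]; simp
  choose! A' E' hst hA' hE' hv' hα hB using hC
  let X : ℕ → Finset ℤ × Finset ℤ := fun k =>
    Nat.rec (∅, ∅) (fun k p => (A' k p.1 p.2 (v k) (B k), E' k p.1 p.2 (v k) (B k))) k
  have hX : ∀ k, IsStage P h f k (X k).1 (X k).2 := by
    intro k
    induction k with
    | zero => exact h0
    | succ k ih => exact hst k _ _ ih (v k) (B k)
  have hXA : Monotone fun k => (X k).1 :=
    monotone_nat_of_le_succ fun k => hA' k _ _ (hX k) (v k) (B k)
  have hXE : Monotone fun k => (X k).2 :=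
    monotone_nat_of_le_succ fun k => hE' k _ _ (hX k) (v k) (B k)
  choose α hαmem hαnew hαle using fun k => hα k _ _ (hX k) (v k) (B k)
  have hXc : Monotone fun k => ((X k).1 : Set ℤ) := fun i j hij => Finset.coe_subset.mpr (hXA hij)
  refine ⟨⋃ k, ((X k).1 : Set ℤ), fun n => ?_, fun k hk => ?_, C, α, ?_, fun k => ⟨?_, hαle k⟩⟩
  · rw [reps_iUnion hXA]
    have hmono : Monotone fun k => reps P h ((X k).1 : Set ℤ) n :=
      fun i j hij => reps_mono P h (hXc hij) n
    refine le_antisymm (encard_iUnion_le hmono fun k => (hX k).reps_le n) ?_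
    have hreach : ∀ j : ℕ, (j : ℕ∞) ≤ f n →
        ∃ k, (j : ℕ∞) ≤ (reps P h ((X k).1 : Set ℤ) n).encard := by
      intro j
      induction j with
      | zero => intro _; exact ⟨0, by simp⟩
      | succ j ih =>
        intro hj
        obtain ⟨K, hK⟩ := ih ((Nat.cast_le.mpr (Nat.le_succ j)).trans hj)
        obtain ⟨k, hKk, hk⟩ := hv n K
        have hKk' := hK.trans (Set.encard_le_encard (hmono hKk))
        by_cases hlt : (reps P h ((X k).1 : Set ℤ) n).encard < f n
        · refine ⟨k + 1, ?_⟩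
          have := hv' k _ _ (hX k) (v k) (B k)
          rw [hk] at this
          push_cast
          exact (add_le_add_left hKk' 1).trans ((this hlt).trans_eq (by rw [← hk]))
        · exact ⟨k, hj.trans (not_lt.mp hlt)⟩
    refine ENat.forall_natCast_le_iff_le.mp fun j hj => ?_
    obtain ⟨k, hk⟩ := hreach j hj
    exact hk.trans (Set.encard_le_encard
      (Set.subset_iUnion (fun k => reps P h ((X k).1 : Set ℤ) n) k))
  · rcases hB k _ _ (hX k) (v k) (B k) with hsub | ⟨e, heE, heB⟩
    -- a set contained in the current stage lacks the element adjoined next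
    · refine hαnew k (hsub (hk ▸ ?_))
      exact Set.mem_iUnion.mpr ⟨k + 1, hαmem k⟩
    · rw [← hk] at heB
      obtain ⟨j, hj⟩ := Set.mem_iUnion.mp heB
      exact (hX (max j (k + 1))).disjoint e (hXA (le_max_left _ _) hj)
        (hXE (le_max_right j (k + 1)) heE)
  · refine Function.Injective.of_lt_imp_ne fun i j hij heq => hαnew j ?_
    rw [← heq]
    exact hXA (Nat.succ_le_of_lt hij) (hαmem i)
  · exact Set.mem_iUnion.mpr ⟨k + 1, hαmem k⟩

/-! ### Representation functions, growth and uncountability -/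

/-- Monotone tuples correspond to multisets by sorting. -/
theorem repFun_eq_encard_reps (A : Set ℤ) (h : ℕ) (n : ℤ) :
    repFun A h n = (reps (fun _ => True) h A n).encard := by
  have hinj : Set.InjOn (fun a : Fin h → ℤ => (List.ofFn a : Multiset ℤ))
      {a : Fin h → ℤ | Monotone a ∧ (∀ i, a i ∈ A) ∧ ∑ i, a i = n} := by
    intro a ha b hb hab
    exact List.ofFn_injective
      ((Multiset.coe_eq_coe.mp hab).eq_of_sortedLE ha.1.sortedLE_ofFn hb.1.sortedLE_ofFn)
  rw [repFun, ← hinj.encard_image]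
  congr 1
  ext M
  constructor
  · rintro ⟨a, ⟨-, hA, hs⟩, rfl⟩
    refine ⟨by simp, trivial, ?_, by simpa [List.sum_ofFn] using hs⟩
    intro x hx
    obtain ⟨i, rfl⟩ := (List.mem_ofFn' _ _).mp (Multiset.mem_coe.mp hx)
    exact hA i
  · rintro ⟨rfl, -, hA, hs⟩
    set L := M.sort (· ≤ ·) with hL
    have hlen : L.length = M.card := Multiset.length_sort _
    have hof : List.ofFn (fun i : Fin M.card => L.get (i.cast hlen.symm)) = L := by
      rw [← List.ofFn_congr hlen L.get, List.ofFn_get]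
    refine ⟨fun i => L.get (i.cast hlen.symm), ⟨?_, fun i => ?_, ?_⟩, ?_⟩
    · rw [← List.sortedLE_ofFn_iff, hof]
      exact (Multiset.pairwise_sort M (· ≤ ·)).sortedLE
    · exact hA _ ((Multiset.mem_sort (· ≤ ·)).mp (List.get_mem L _))
    · rw [← List.sum_ofFn, hof, ← Multiset.sum_coe, hL, Multiset.sort_eq, hs]
    · change ((List.ofFn _ : List ℤ) : Multiset ℤ) = M
      rw [hof, hL, Multiset.sort_eq]

theorem restrictedRepFun_eq_encard_reps (A : Set ℤ) (h : ℕ) (n : ℤ) :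
    restrictedRepFun A h n = (reps Multiset.Nodup h A n).encard := by
  rw [restrictedRepFun, ← Finset.val_injective.encard_image]
  congr 1
  ext M
  constructor
  · rintro ⟨s, ⟨hc, hA, hs⟩, rfl⟩
    exact ⟨hc, s.nodup, hA, by rw [Finset.sum_val]; exact hs⟩
  · rintro ⟨hc, hnd, hA, hs⟩
    exact ⟨⟨M, hnd⟩, ⟨hc, hA, hs ▸ (Finset.sum_val ⟨M, hnd⟩).symm⟩, rfl⟩

/-- Distinct elements `α k` of size `O(k ^ d)` make the counting function at least of order
`x ^ (1 / d)`. -/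
theorem muchGreater_countFun {A : Set ℤ} {C d : ℕ} (hd : 0 < d) {α : ℕ → ℤ} (hα : α.Injective)
    (hA : ∀ k, α k ∈ A ∧ |α k| ≤ C * ((k : ℤ) + 1) ^ d) :
    MuchGreater (fun x => (countFun A (-x) x : ℝ)) (fun x => x ^ (1 / (d : ℝ))) := by
  -- `C` may be `0`, so it is replaced by a positive constant
  set D : ℝ := C + 1 with hD
  have hDpos : 0 < D := by positivity
  refine ⟨(2 * D ^ (1 / (d : ℝ)))⁻¹, by positivity, D, fun x hx => ?_⟩
  have hx0 : 0 < x := hDpos.trans_le hx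
  set y : ℝ := (x / D) ^ (1 / (d : ℝ)) with hy
  have hy1 : 1 ≤ y := Real.one_le_rpow ((one_le_div hDpos).mpr hx) (by positivity)
  have hyd : y ^ d = x / D := by
    rw [hy, one_div, Real.rpow_inv_natCast_pow (by positivity) hd.ne']
  have hcount : ⌊y⌋₊ ≤ countFun A (-x) x := by
    have hfin : {a : ℤ | a ∈ A ∧ -x ≤ (a : ℝ) ∧ (a : ℝ) ≤ x}.Finite := by
      refine (Set.finite_Icc ⌈-x⌉ ⌊x⌋).subset fun a ha => ?_
      exact ⟨Int.ceil_le.mpr ha.2.1, Int.le_floor.mpr ha.2.2⟩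
    have hsub : (((Finset.range ⌊y⌋₊).image α : Finset ℤ) : Set ℤ)
        ⊆ {a : ℤ | a ∈ A ∧ -x ≤ (a : ℝ) ∧ (a : ℝ) ≤ x} := by
      intro a ha
      obtain ⟨k, hk, rfl⟩ := Finset.mem_image.mp (Finset.mem_coe.mp ha)
      refine ⟨(hA k).1, abs_le.mp ?_⟩
      have hky : (k : ℝ) + 1 ≤ y := by
        have : k + 1 ≤ ⌊y⌋₊ := Finset.mem_range.mp hk
        exact_mod_cast (Nat.cast_le.mpr this).trans (Nat.floor_le (by linarith))
      have h1 : |((α k : ℤ) : ℝ)| ≤ C * ((k : ℝ) + 1) ^ d := by exact_mod_cast (hA k).2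
      calc |((α k : ℤ) : ℝ)| ≤ C * ((k : ℝ) + 1) ^ d := h1
        _ ≤ D * y ^ d := by gcongr; linarith
        _ = x := by rw [hyd]; field_simp
    have := Set.ncard_le_ncard hsub hfin
    rwa [Set.ncard_coe_finset, Finset.card_image_of_injective _ hα, Finset.card_range] at this
  have hfl : y ≤ 2 * (⌊y⌋₊ : ℝ) := by
    have h1 := Nat.lt_floor_add_one y
    have h2 : (1 : ℝ) ≤ ⌊y⌋₊ := by exact_mod_cast (Nat.one_le_floor_iff y).mpr hy1
    linarith
  have hxy : x ^ (1 / (d : ℝ)) = D ^ (1 / (d : ℝ)) * y := by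
    rw [hy, ← Real.mul_rpow hDpos.le (by positivity)]
    congr 1
    field_simp
  have hc : (⌊y⌋₊ : ℝ) ≤ countFun A (-x) x := by exact_mod_cast hcount
  simp only [Nat.abs_cast]
  rw [abs_of_nonneg (by positivity), hxy]
  have hDp : 0 < D ^ (1 / (d : ℝ)) := by positivity
  calc (2 * D ^ (1 / (d : ℝ)))⁻¹ * (D ^ (1 / (d : ℝ)) * y) = y / 2 := by field_simp
    _ ≤ countFun A (-x) x := by linarith

/-- The sets in question cannot be listed, as `exists_set_reps_eq` avoids any given sequence. -/
theorem not_countable_setOf_reps_eq {P : Multiset ℤ → Prop} (hP : ∀ M, M.Nodup → P M) {h : ℕ}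
    (hh : 2 ≤ h) {f : ℤ → ℕ∞} (hf : (f ⁻¹' {0}).Finite) :
    ¬ {A : Set ℤ | (∀ n : ℤ, (reps P h A n).encard = f n) ∧
        MuchGreater (fun x => (countFun A (-x) x : ℝ))
          (fun x => x ^ (1 / (2 * (h : ℝ) - 1)))}.Countable := by
  intro hcount
  obtain ⟨B, hB⟩ := Set.countable_iff_exists_subset_range.mp hcount
  obtain ⟨A, hA, hne, C, α, hα, hαA⟩ := exists_set_reps_eq hP hh hf B
  have hd : ((2 * h - 1 : ℕ) : ℝ) = 2 * (h : ℝ) - 1 := by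
    rw [Nat.cast_sub (by omega)]; push_cast; ring
  have hgrow := muchGreater_countFun (d := 2 * h - 1) (by omega) hα hαA
  rw [hd] at hgrow
  obtain ⟨k, hk⟩ := hB (show A ∈ _ from ⟨hA, hgrow⟩)
  exact hne k hk.symm

theorem theorem3 (h : ℕ) (hh : 2 ≤ h) (f : ℤ → ℕ∞) (hf : (f ⁻¹' {0}).Finite) :
    ¬ {A : Set ℤ | (∀ n : ℤ, repFun A h n = f n) ∧
        MuchGreater (fun x => (countFun A (-x) x : ℝ))
          (fun x => x ^ (1 / (2 * (h : ℝ) - 1)))}.Countable ∧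
    ¬ {A : Set ℤ | (∀ n : ℤ, restrictedRepFun A h n = f n) ∧
        MuchGreater (fun x => (countFun A (-x) x : ℝ))
          (fun x => x ^ (1 / (2 * (h : ℝ) - 1)))}.Countable := by
  constructor
  · simp only [repFun_eq_encard_reps]
    exact not_countable_setOf_reps_eq (fun _ _ => trivial) hh hf
  · simp only [restrictedRepFun_eq_encard_reps]
    exact not_countable_setOf_reps_eq (fun _ hM => hM) hh hf
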